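/- Let $Q$ be a smooth ($C^\infty$, finite-dimensional, Hausdorff, boundaryless) manifold and $\tau_{\bar E}:\bar E\to Q$ a smooth real vector bundle of finite rank with dual bundle $\tau_{\bar E^*}:\bar E^*\to Q$. Let $([\![\cdot,\cdot]\!],\rho)$ be a skew-symmetric algebroid structure on $\bar E$: $[\![\cdot,\cdot]\!]$ is an $\mathbb R$-bilinear skew-symmetric bracket on $\Gamma(\bar E)$ and $\rho:\bar E\to TQ$ (the anchor) is a vector bundle morphism over $\mathrm{id}_Q$ such that $[\![\sigma,f\gamma]\!]=f[\![\sigma,\gamma]\!]+\rho(\sigma)(f)\,\gamma$ for $\sigma,\gamma\in\Gamma(\bar E)$ and $f\in C^\infty(Q)$. (A Lie algebroid is the special case in which $[\![\cdot,\cdot]\!]$ satisfies the Jacobi identity.) Let $H\in C^\infty(\bar E^*)$, let $F:\bar E\to\bar E$ be a vector bundle homomorphism over $\mathrm{id}_Q$, and let $\alpha\in\Gamma(\bar E^*)$. Notation: - $d^{\bar E}f(\sigma)=\rho(\sigma)(f)$ for $f\in C^\infty(Q)$, and $d^{\bar E}\alpha(\sigma,\gamma)=\rho(\sigma)(\alpha(\gamma))-\rho(\gamma)(\alpha(\sigma))-\alpha([\![\sigma,\gamma]\!])$.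 - For $\sigma\in\Gamma(\bar E)$, $\hat\sigma\in C^\infty(\bar E^*)$ is the linear function $\hat\sigma(p)=p(\sigma(\tau_{\bar E^*}(p)))$. $\Pi_{\bar E^*}$ is the linear almost Poisson bivector on $\bar E^*$, i.e. the unique bivector whose bracket $\{\varphi,\psi\}=\Pi_{\bar E^*}(d\varphi,d\psi)$ satisfies $\{\hat\sigma,\hat\gamma\}=-\widehat{[\![\sigma,\gamma]\!]}$, $\{f\circ\tau_{\bar E^*},\hat\sigma\}=\rho(\sigma)(f)\circ\tau_{\bar E^*}$ and $\{f\circ\tau_{\bar E^*},g\circ\tau_{\bar E^*}\}=0$. The hamiltonian vector field of $H$ is $\mathcal H_H^{\Pi_{\bar E^*}}=-i_{dH}\Pi_{\bar E^*}$, i.e. $\mathcal H_H^{\Pi_{\bar E^*}}(\varphi)=\{\varphi,H\}$. - For $\beta\in\Gamma(\bar E^*)$, $\beta^\vee$ is its vertical lift to $\bar E^*$, $\beta^\vee(p)=\frac{d}{dt}\big|_{t=0}(p+t\,\beta(\tau_{\bar E^*}(p)))$. The section $\zeta_H^\alpha\in\Gamma(\bar E)$ is determined by $\beta(\zeta_H^\alpha)=\beta^\vee(H)\circ\alpha$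 for all $\beta\in\Gamma(\bar E^*)$. - $F^*:\bar E^*\to\bar E^*$ is $F^*(p)=p\circ F$, and $(F^*)^\vee$ is the vertical vector field on $\bar E^*$ given by $(F^*)^\vee(p)=\frac{d}{dt}\big|_{t=0}(p+t\,F^*(p))$. Then the following statements are equivalent: (i) for every open interval $I\subseteq\mathbb R$, if $c:I\to Q$ is an integral curve of the vector field $T\tau_{\bar E^*}\circ\mathcal H_H^{\Pi_{\bar E^*}}\circ\alpha$ on $Q$, then $\alpha\circ c:I\to\bar E^*$ is an integral curve of $\mathcal H_H^{\Pi_{\bar E^*}}-(F^*)^\vee$; (ii) $\alpha$ satisfies the Hamilton–Jacobi equation $$i_{\zeta_H^\alpha}\,d^{\bar E}\alpha+d^{\bar E}(H\circ\alpha)+F^*(\alpha)=0 .$$ -/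

import Mathlib

open Bundle Set Filter
open scoped Manifold ContDiff Topology

set_option linter.unusedSectionVars false

noncomputable section
namespace SkewAlgebroid

section Basic

variable (B : Type*) [NormedAddCommGroup B] [NormedSpace ℝ B]
  {Q : Type*} [TopologicalSpace Q] [ChartedSpace B Q]
  (V : Type*) [NormedAddCommGroup V] [NormedSpace ℝ V]
  (E : Q → Type*) [TopologicalSpace (TotalSpace V E)] [∀ q, TopologicalSpace (E q)]
  [∀ q, AddCommGroup (E q)] [∀ q, Module ℝ (E q)]
  [FiberBundle V E] [VectorBundle ℝ V E]

/-- The space `Γ(E)` of smooth sections of the vector bundle `E → Q`. -/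
abbrev Sec : Type _ := ContMDiffSection 𝓘(ℝ, B) V ∞ E

variable {B V E}

/-- The product `f σ` of a smooth function and a smooth section. -/
def smulSec [ContMDiffVectorBundle ∞ V E 𝓘(ℝ, B)] (f : C^∞⟮𝓘(ℝ, B), Q; ℝ⟯) (σ : Sec B V E) :
    Sec B V E :=
  ⟨fun q => f q • σ q, f.contMDiff.smul_section σ.contMDiff⟩

variable [FiniteDimensional ℝ B] [T2Space Q] [IsManifold 𝓘(ℝ, B) ∞ Q]
  [ContMDiffVectorBundle ∞ V E 𝓘(ℝ, B)]

variable (B) in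
theorem exists_bump (q : Q) {u : Set Q} (hu : u ∈ 𝓝 q) :
    ∃ ψ : C^∞⟮𝓘(ℝ, B), Q; ℝ⟯, ψ q = 1 ∧ tsupport ψ ⊆ u := by
  obtain ⟨f, -, hf⟩ := (SmoothBumpFunction.nhds_basis_tsupport (I := 𝓘(ℝ, B)) q).mem_iff.1 hu
  exact ⟨⟨f, f.contMDiff⟩, f.eq_one, hf⟩

variable (B V E) in
/-- Vectors of a fibre extend linearly to global smooth sections. -/
theorem exists_extension (q : Q) :
    ∃ s : E q →ₗ[ℝ] Sec B V E, ∀ v, s v q = v := by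
  set e := trivializationAt V E q with he
  have hq : q ∈ e.baseSet := FiberBundle.mem_baseSet_trivializationAt' q
  obtain ⟨ψ, hψ, hs⟩ := exists_bump B q (e.open_baseSet.mem_nhds hq)
  have key : ∀ w : V, ContMDiff 𝓘(ℝ, B) (𝓘(ℝ, B).prod 𝓘(ℝ, V)) ∞
      (fun x => TotalSpace.mk' V x (((ψ : Q → ℝ) • (fun x => e.symmL ℝ x w) : ∀ x, E x) x)) := by
    intro w
    refine ContMDiffOn.smul_section_of_tsupport (u := e.baseSet) ψ.contMDiff.contMDiffOn
      e.open_baseSet hs ?_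
    intro x hx
    rw [e.contMDiffWithinAt_section _ hx]
    have : ContMDiffOn 𝓘(ℝ, B) 𝓘(ℝ, V) ∞ (fun _ : Q => w) e.baseSet := contMDiffOn_const
    refine (this.congr fun y hy => ?_) x hx
    simp [hy, e.symmL_apply]
  refine ⟨⟨⟨fun v => ⟨_, key (e.continuousLinearMapAt ℝ q v)⟩, fun v w => ?_⟩,
    fun c v => ?_⟩, fun v => ?_⟩
  · ext x
    exact (congrArg (ψ x • ·) (by rw [map_add]; exact map_add _ _ _)).trans (smul_add _ _ _)
  · ext x
    exact (congrArg (ψ x • ·) (by rw [map_smul]; exact map_smul _ _ _)).trans (smul_comm _ _ _)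
  · show ψ q • e.symmL ℝ q (e.continuousLinearMapAt ℝ q v) = v
    rw [e.symmL_continuousLinearMapAt hq, hψ, one_smul]

theorem tensorial {q : Q} (T : Sec B V E →ₗ[ℝ] ℝ) [FiniteDimensional ℝ V]
    (hT : ∀ f σ, T (smulSec f σ) = f q * T σ) (σ : Sec B V E) (hσ : σ q = 0) : T σ = 0 := by
  set e := trivializationAt V E q with he
  have hq : q ∈ e.baseSet := FiberBundle.mem_baseSet_trivializationAt' q
  obtain ⟨ψ, hψ, hs⟩ := exists_bump B q (e.open_baseSet.mem_nhds hq)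
  let b := Module.finBasis ℝ V
  have : ContMDiffVectorBundle 1 V E 𝓘(ℝ, B) := .of_le (n := ∞) (by simp)
  let fr : ∀ i, Sec B V E := fun i => ⟨_, ContMDiffOn.smul_section_of_tsupport (u := e.baseSet)
    ψ.contMDiff.contMDiffOn e.open_baseSet hs (e.contMDiffOn_localFrame_baseSet (I := 𝓘(ℝ, B)) ∞ b i)⟩
  have hco : ∀ i, ContMDiff 𝓘(ℝ, B) 𝓘(ℝ, ℝ) ∞
      (fun x => ψ x • (e.localFrameCoeff 𝓘(ℝ, B) b i x (σ x))) := by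
    intro i
    refine contMDiff_of_tsupport fun x hx => ?_
    have hx' : x ∈ e.baseSet := hs (tsupport_smul_subset_left _ _ hx)
    exact ψ.contMDiff.contMDiffAt.smul
      (contMDiffAt_localFrameCoeff b hx' (σ.contMDiff x) i)
  let co : ∀ i, C^∞⟮𝓘(ℝ, B), Q; ℝ⟯ := fun i => ⟨_, hco i⟩
  have h1 : σ = ∑ i, smulSec (co i) (fr i) + smulSec (1 - ψ * ψ) σ := by
    ext x
    have hsum : (∑ i, smulSec (co i) (fr i) : Sec B V E) x = ∑ i, smulSec (co i) (fr i) x := by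
      have := congrFun (map_sum (ContMDiffSection.coeAddHom 𝓘(ℝ, B) V ∞ E)
        (fun i => smulSec (co i) (fr i)) Finset.univ) x
      rw [Finset.sum_apply] at this
      exact this
    have h3 : ∀ i, smulSec (co i) (fr i) x =
        (ψ x * ψ x) • (e.localFrameCoeff 𝓘(ℝ, B) b i x (σ x) • e.localFrame b i x) := by
      intro i
      show (ψ x • (e.localFrameCoeff 𝓘(ℝ, B) b i x (σ x))) • (ψ x • e.localFrame b i x) = _
      simp only [smul_smul, smul_eq_mul]; ring_nf
    have h4 : smulSec (1 - ψ * ψ) σ x = (1 - ψ x * ψ x) • σ x := rfl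
    rw [ContMDiffSection.coe_add, Pi.add_apply, hsum, h4, Finset.sum_congr rfl fun i _ => h3 i,
      ← Finset.smul_sum]
    by_cases hx : x ∈ e.baseSet
    · rw [← e.eq_sum_localFrameCoeff_smul (s := σ) hx, ← add_smul]; simp
    · have : ψ x = 0 := image_eq_zero_of_notMem_tsupport fun h => hx (hs h)
      simp [this]
  have h2 : ∀ i, co i q = 0 := by
    intro i
    show ψ q • (e.localFrameCoeff 𝓘(ℝ, B) b i q (σ q)) = 0
    rw [hσ]; simp
  rw [h1, map_add, map_sum, hT]
  simp [hT, h2, hψ]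

end Basic

section Structure

variable (B : Type*) [NormedAddCommGroup B] [NormedSpace ℝ B]
  {Q : Type*} [TopologicalSpace Q] [ChartedSpace B Q] [IsManifold 𝓘(ℝ, B) ∞ Q]
  (V : Type*) [NormedAddCommGroup V] [NormedSpace ℝ V]
  (E : Q → Type*) [TopologicalSpace (TotalSpace V E)] [∀ q, TopologicalSpace (E q)]
  [∀ q, AddCommGroup (E q)] [∀ q, Module ℝ (E q)]
  [∀ q, IsTopologicalAddGroup (E q)] [∀ q, ContinuousSMul ℝ (E q)]
  [FiberBundle V E] [VectorBundle ℝ V E] [ContMDiffVectorBundle ∞ V E 𝓘(ℝ, B)]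

/-- The fibre `E_q^*` of the dual bundle `E^*`. -/
abbrev DualFiber {Q : Type*} (E : Q → Type*) [∀ q, TopologicalSpace (E q)]
    [∀ q, AddCommGroup (E q)] [∀ q, Module ℝ (E q)] (q : Q) : Type _ :=
  E q →L[ℝ] Bundle.Trivial Q ℝ q

/-- The space `Γ(E^*)` of smooth sections of the dual bundle. -/
abbrev DualSec : Type _ := Sec B (V →L[ℝ] ℝ) (DualFiber E)

/-- A skew-symmetric algebroid structure on the vector bundle `E → Q`: an `ℝ`-bilinear
skew-symmetric bracket on `Γ(E)` and a vector bundle map `ρ : E → TQ` (the anchor, a smooth section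
of `Hom(E, TQ)`) such that `[σ, f γ] = f [σ, γ] + ρ(σ)(f) γ`. -/
structure Algebroid where
  bracket : Sec B V E →ₗ[ℝ] Sec B V E →ₗ[ℝ] Sec B V E
  anchor : Sec B (V →L[ℝ] B) (fun q => E q →L[ℝ] TangentSpace 𝓘(ℝ, B) q)
  skew : ∀ σ γ, bracket σ γ = -bracket γ σ
  leibniz : ∀ (σ γ : Sec B V E) (f : C^∞⟮𝓘(ℝ, B), Q; ℝ⟯) (q : Q),
    bracket σ (smulSec f γ) q =
      f q • bracket σ γ q + (mvfderiv 𝓘(ℝ, B) f q (anchor q (σ q))) • γ q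

variable {B V E}

/-- The function `α(σ)` on `Q`. -/
def pair (α : DualSec B V E) (σ : Sec B V E) : Q → ℝ := fun q => α q (σ q)

theorem contMDiff_pair (α : DualSec B V E) (σ : Sec B V E) :
    ContMDiff 𝓘(ℝ, B) 𝓘(ℝ, ℝ) ∞ (pair α σ) := by
  have h := α.contMDiff.clm_bundle_apply σ.contMDiff
  intro x
  exact (contMDiffAt_section (F := ℝ) (E := Bundle.Trivial Q ℝ) x).1 (h x)

theorem pair_add (α : DualSec B V E) (σ γ : Sec B V E) :
    pair α (σ + γ) = pair α σ + pair α γ := by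
  ext x; simp [pair]

theorem pair_smul (α : DualSec B V E) (c : ℝ) (σ : Sec B V E) :
    pair α (c • σ) = c • pair α σ := by
  ext x; simp [pair]

namespace Algebroid
variable (A : Algebroid B V E)

/-- The almost differential of a function: `(d^E f)_q(v) = (ρ v)(f)`. -/
def dFun (f : Q → ℝ) (q : Q) : E q →L[ℝ] ℝ := mvfderiv 𝓘(ℝ, B) f q ∘L A.anchor q

/-- `(d^E α)(σ, γ) = ρ(σ)(α(γ)) - ρ(γ)(α(σ)) - α([σ, γ])` for sections `σ`, `γ` of `E`. -/
def dFormSec (α : DualSec B V E) (σ γ : Sec B V E) (q : Q) : ℝ :=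
  A.dFun (pair α γ) q (σ q) - A.dFun (pair α σ) q (γ q) - pair α (A.bracket σ γ) q

theorem mdiff (f : C^∞⟮𝓘(ℝ, B), Q; ℝ⟯) (q : Q) :
    MDifferentiableAt 𝓘(ℝ, B) 𝓘(ℝ, ℝ) f q :=
  f.contMDiff.mdifferentiableAt (by simp)

theorem mdiff_pair (α : DualSec B V E) (σ : Sec B V E) (q : Q) :
    MDifferentiableAt 𝓘(ℝ, B) 𝓘(ℝ, ℝ) (pair α σ) q :=
  (contMDiff_pair α σ).mdifferentiableAt (by simp)

theorem dFormSec_skew (α : DualSec B V E) (σ γ : Sec B V E) (q : Q) :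
    A.dFormSec α σ γ q = -A.dFormSec α γ σ q := by
  have : pair α (A.bracket σ γ) q = -pair α (A.bracket γ σ) q := by
    rw [A.skew]; simp [pair]
  simp only [dFormSec, this]; ring

theorem dFormSec_add (α : DualSec B V E) (σ γ τ : Sec B V E) (q : Q) :
    A.dFormSec α σ (γ + τ) q = A.dFormSec α σ γ q + A.dFormSec α σ τ q := by
  simp only [dFormSec, dFun, pair_add, map_add]
  rw [mvfderiv_add (mdiff_pair α γ q) (mdiff_pair α τ q)]
  simp
  ring

theorem dFormSec_smulSec (α : DualSec B V E) (σ γ : Sec B V E) (f : C^∞⟮𝓘(ℝ, B), Q; ℝ⟯) (q : Q) :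
    A.dFormSec α σ (smulSec f γ) q = f q * A.dFormSec α σ γ q := by
  have h1 : pair α (smulSec f γ) = f * pair α γ := by ext x; simp [pair, smulSec]
  have h2 : pair α (A.bracket σ (smulSec f γ)) q =
      f q * pair α (A.bracket σ γ) q +
        mvfderiv 𝓘(ℝ, B) f q (A.anchor q (σ q)) * pair α γ q := by
    simp [pair, A.leibniz]
  have h3 : smulSec f γ q = f q • γ q := rfl
  simp only [dFormSec, dFun, h1, h2, h3]
  rw [mvfderiv_mul (mdiff f q) (mdiff_pair α γ q)]
  simp
  ring

theorem dFormSec_smul (α : DualSec B V E) (σ γ : Sec B V E) (c : ℝ) (q : Q) :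
    A.dFormSec α σ (c • γ) q = c * A.dFormSec α σ γ q :=
  A.dFormSec_smulSec α σ γ (ContMDiffMap.const c) q

variable [FiniteDimensional ℝ B] [FiniteDimensional ℝ V] [T2Space Q]

/-- `d^E α` is a section of `∧² E^*`. -/
theorem existsUnique_dForm (α : DualSec B V E) (q : Q) :
    ∃! D : E q →ₗ[ℝ] E q →ₗ[ℝ] ℝ, ∀ σ γ : Sec B V E, D (σ q) (γ q) = A.dFormSec α σ γ q := by
  obtain ⟨s, hs⟩ := exists_extension B V E q
  let T : Sec B V E → Sec B V E →ₗ[ℝ] ℝ := fun σ =>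
    ⟨⟨fun γ => A.dFormSec α σ γ q, fun _ _ => A.dFormSec_add ..⟩, fun _ _ => A.dFormSec_smul ..⟩
  have h1 : ∀ σ γ τ : Sec B V E, γ q = τ q → A.dFormSec α σ γ q = A.dFormSec α σ τ q := by
    intro σ γ τ h
    have : T σ (γ - τ) = 0 :=
      tensorial (T σ) (fun f γ => A.dFormSec_smulSec ..) _ (by simp [h])
    rw [map_sub, sub_eq_zero] at this
    exact this
  have h2 : ∀ σ τ γ : Sec B V E, σ q = τ q → A.dFormSec α σ γ q = A.dFormSec α τ γ q := by
    intro σ τ γ h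
    rw [A.dFormSec_skew, h1 γ σ τ h, ← A.dFormSec_skew]
  refine ⟨LinearMap.mk₂ ℝ (fun u v => A.dFormSec α (s u) (s v) q) ?_ ?_ ?_ ?_, ?_, ?_⟩
  · intro u v w
    rw [A.dFormSec_skew, map_add, A.dFormSec_add, A.dFormSec_skew α (s u), A.dFormSec_skew α (s v)]
    ring
  · intro c u w
    rw [A.dFormSec_skew, map_smul, A.dFormSec_smul, A.dFormSec_skew α (s u), smul_eq_mul]
    ring
  · intro u v w
    rw [map_add, A.dFormSec_add]
  · intro c u w
    rw [map_smul, A.dFormSec_smul, smul_eq_mul]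
  · intro σ γ
    exact (h1 _ _ _ (hs _)).trans (h2 _ _ _ (hs _))
  · intro D hD
    ext u v
    have := hD (s u) (s v)
    rw [hs, hs] at this
    exact this

/-- The almost differential `(d^E α)_q : E_q × E_q → ℝ` of a section `α` of `E^*`. -/
def dForm (α : DualSec B V E) (q : Q) : E q →ₗ[ℝ] E q →ₗ[ℝ] ℝ :=
  (A.existsUnique_dForm α q).choose

end Algebroid
end Structure
section Reflexive

theorem existsUnique_dual_repr {W : Type*} [AddCommGroup W] [Module ℝ W] [TopologicalSpace W]
    [IsTopologicalAddGroup W] [ContinuousSMul ℝ W] [T2Space W] [FiniteDimensional ℝ W]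
    (φ : (W →L[ℝ] ℝ) →ₗ[ℝ] ℝ) : ∃! w : W, ∀ θ : W →L[ℝ] ℝ, θ w = φ θ := by
  let φ' : Module.Dual ℝ (Module.Dual ℝ W) :=
    φ ∘ₗ (LinearMap.toContinuousLinearMap (𝕜 := ℝ) (E := W) (F' := ℝ)).toLinearMap
  refine ⟨(Module.evalEquiv ℝ W).symm φ', fun θ => ?_, fun w hw => ?_⟩
  · have := Module.apply_evalEquiv_symm_apply ℝ W (θ : W →ₗ[ℝ] ℝ) φ'
    refine this.trans ?_
    show φ (LinearMap.toContinuousLinearMap (θ : W →ₗ[ℝ] ℝ)) = φ θ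
    congr 1
  · rw [LinearEquiv.eq_symm_apply]
    ext θ
    exact hw (LinearMap.toContinuousLinearMap θ)

end Reflexive

section Dual

variable (B : Type*) [NormedAddCommGroup B] [NormedSpace ℝ B]
  {Q : Type*} [TopologicalSpace Q] [ChartedSpace B Q]
  (V : Type*) [NormedAddCommGroup V] [NormedSpace ℝ V]
  (E : Q → Type*) [TopologicalSpace (TotalSpace V E)] [∀ q, TopologicalSpace (E q)]
  [∀ q, AddCommGroup (E q)] [∀ q, Module ℝ (E q)]
  [FiberBundle V E] [VectorBundle ℝ V E]

/-- The model with corners of the manifold `E^*`. -/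
abbrev dualModel (B : Type*) [NormedAddCommGroup B] [NormedSpace ℝ B]
    (V : Type*) [NormedAddCommGroup V] [NormedSpace ℝ V] :=
  𝓘(ℝ, B).prod 𝓘(ℝ, V →L[ℝ] ℝ)

/-- The total space `E^*` of the dual bundle. -/
abbrev DualTotal : Type _ := TotalSpace (V →L[ℝ] ℝ) (DualFiber E)

variable {V E}

/-- The tangent space `T_p E^*`. -/
abbrev TDual (p : DualTotal V E) : Type _ := TangentSpace (dualModel B V) p

/-- The projection `τ : E^* → Q`. -/
def proj (p : DualTotal V E) : Q := p.1

variable {B}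

/-- The canonical isomorphism of `E_q^*` onto the vertical tangent vectors at `p ∈ E_q^*`:
the velocity at `t = 0` of the curve `p + t θ`. -/
def vertLift (p : DualTotal V E) (θ : DualFiber E p.1) : TDual B p :=
  mfderiv 𝓘(ℝ, ℝ) (dualModel B V)
    (fun t : ℝ => (⟨p.1, p.2 + t • θ⟩ : DualTotal V E)) 0 (1 : ℝ)

theorem hasMFDerivAt_vertLift (p : DualTotal V E) (θ : DualFiber E p.1) :
    HasMFDerivAt 𝓘(ℝ, ℝ) (dualModel B V)
      (fun t : ℝ => (⟨p.1, p.2 + t • θ⟩ : DualTotal V E)) 0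
      ((1 : ℝ →L[ℝ] ℝ).smulRight
        ((0, (trivializationAt (V →L[ℝ] ℝ) (DualFiber E) p.1).continuousLinearMapAt ℝ p.1 θ) :
          B × (V →L[ℝ] ℝ))) := by
  set e := trivializationAt (V →L[ℝ] ℝ) (DualFiber E) p.1 with he
  have hq : p.1 ∈ e.baseSet := FiberBundle.mem_baseSet_trivializationAt' p.1
  have hc : ∀ t : ℝ, (e ⟨p.1, p.2 + t • θ⟩).2 =
      (e p).2 + t • e.continuousLinearMapAt ℝ p.1 θ := by
    intro t
    have h := map_add (e.continuousLinearMapAt ℝ p.1) p.2 (t • θ)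
    rw [map_smul] at h
    simpa [Trivialization.continuousLinearMapAt_apply, e.coe_linearMapAt_of_mem hq] using h
  constructor
  · rw [FiberBundle.continuousAt_totalSpace]
    refine ⟨continuousAt_const, ?_⟩
    have h0 : (fun t : ℝ => (e ⟨p.1, p.2 + t • θ⟩).2) =
        fun t : ℝ => (e p).2 + t • e.continuousLinearMapAt ℝ p.1 θ := funext hc
    show ContinuousAt (fun t : ℝ => (e ⟨p.1, p.2 + t • θ⟩).2) 0
    rw [h0]
    fun_prop
  · have h0 : writtenInExtChartAt 𝓘(ℝ, ℝ) (dualModel B V) 0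
        (fun t : ℝ => (⟨p.1, p.2 + t • θ⟩ : DualTotal V E)) =
        fun t : ℝ => (extChartAt 𝓘(ℝ, B) p.1 p.1,
          (e p).2 + t • e.continuousLinearMapAt ℝ p.1 θ) := by
      funext t
      have h3 := hc t
      have h4 : (e ⟨p.1, p.2 + t • θ⟩).1 = p.1 := e.coe_fst' hq
      have h5 : p.2 + (0 : ℝ) • θ = p.2 := by simp
      simp only [writtenInExtChartAt, FiberBundle.extChartAt, Function.comp_apply]
      rw [← h3]
      exact Prod.ext (congrArg (extChartAt 𝓘(ℝ, B) p.1) h4) rfl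
    rw [h0]
    have h1 : HasFDerivAt (fun t : ℝ => (extChartAt 𝓘(ℝ, B) p.1 p.1,
          (e p).2 + t • e.continuousLinearMapAt ℝ p.1 θ))
        ((0 : ℝ →L[ℝ] B).prod
          ((1 : ℝ →L[ℝ] ℝ).smulRight (e.continuousLinearMapAt ℝ p.1 θ))) (0 : ℝ) :=
      (hasFDerivAt_const _ _).prodMk (((hasFDerivAt_id _).smul_const _).const_add _)
    have h2 : ((0 : ℝ →L[ℝ] B).prod
          ((1 : ℝ →L[ℝ] ℝ).smulRight (e.continuousLinearMapAt ℝ p.1 θ))) =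
        (1 : ℝ →L[ℝ] ℝ).smulRight
        ((0, e.continuousLinearMapAt ℝ p.1 θ) : B × (V →L[ℝ] ℝ)) := by
      ext <;> simp
    rw [h2] at h1
    exact h1.hasFDerivWithinAt

theorem vertLift_eq (p : DualTotal V E) (θ : DualFiber E p.1) :
    (vertLift p θ : TDual B p) =
      ((0, (trivializationAt (V →L[ℝ] ℝ) (DualFiber E) p.1).continuousLinearMapAt ℝ p.1 θ) :
          B × (V →L[ℝ] ℝ)) := by
  have := (hasMFDerivAt_vertLift (B := B) p θ).mfderiv
  unfold vertLift
  rw [this]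
  exact one_smul ℝ ((0, _) : B × (V →L[ℝ] ℝ))

variable (B) in
/-- The vertical lift at `p` as a linear map. -/
def vertLiftLin (p : DualTotal V E) : DualFiber E p.1 →ₗ[ℝ] TDual B p where
  toFun := vertLift p
  map_add' θ θ' := by
    have h : ∀ a b : V →L[ℝ] ℝ, ((0, a + b) : B × (V →L[ℝ] ℝ)) = (0, a) + (0, b) := by simp
    simp only [vertLift_eq, map_add]
    exact h _ _
  map_smul' c θ := by
    have h : ∀ a : V →L[ℝ] ℝ, ((0, c • a) : B × (V →L[ℝ] ℝ)) = c • (0, a) := by simp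
    simp only [vertLift_eq, map_smul]
    exact h _

theorem t2Space_fiber (V : Type*) [NormedAddCommGroup V] [NormedSpace ℝ V]
  (E : Q → Type*) [TopologicalSpace (TotalSpace V E)] [∀ q, TopologicalSpace (E q)]
  [∀ q, AddCommGroup (E q)] [∀ q, Module ℝ (E q)]
  [FiberBundle V E] [VectorBundle ℝ V E]  (q : Q) : T2Space (E q) := by
  have := (VectorBundle.continuousLinearEquivAt ℝ V E q).toHomeomorph
  exact this.symm.t2Space

variable [∀ q, IsTopologicalAddGroup (E q)] [∀ q, ContinuousSMul ℝ (E q)]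
  [FiniteDimensional ℝ B] [FiniteDimensional ℝ V]

theorem existsUnique_fiberPart (p : DualTotal V E) (η : TDual B p →L[ℝ] ℝ) :
    ∃! v : E p.1, ∀ θ : DualFiber E p.1, θ v = η (vertLift p θ) := by
  have := t2Space_fiber V E p.1
  have := VectorBundle.finiteDimensional ℝ V E p.1
  exact existsUnique_dual_repr ((η : TDual B p →ₗ[ℝ] ℝ) ∘ₗ vertLiftLin B p)

/-- The element `η̃ ∈ E_q` associated with a covector `η ∈ T_p^* E^*`, `p ∈ E_q^*`:
`θ(η̃) = η(θ^∨)` for all `θ ∈ E_q^*`. -/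
def fiberPart (p : DualTotal V E) (η : TDual B p →L[ℝ] ℝ) : E p.1 :=
  (existsUnique_fiberPart p η).choose

end Dual
section Poisson

variable {B : Type*} [NormedAddCommGroup B] [NormedSpace ℝ B]
  {Q : Type*} [TopologicalSpace Q] [ChartedSpace B Q] [IsManifold 𝓘(ℝ, B) ∞ Q]
  {V : Type*} [NormedAddCommGroup V] [NormedSpace ℝ V]
  {E : Q → Type*} [TopologicalSpace (TotalSpace V E)] [∀ q, TopologicalSpace (E q)]
  [∀ q, AddCommGroup (E q)] [∀ q, Module ℝ (E q)]
  [∀ q, IsTopologicalAddGroup (E q)] [∀ q, ContinuousSMul ℝ (E q)]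
  [FiberBundle V E] [VectorBundle ℝ V E] [ContMDiffVectorBundle ∞ V E 𝓘(ℝ, B)]

/-- The linear function `σ̂` on `E^*` associated with a section `σ` of `E`. -/
def hat (σ : Sec B V E) (p : DualTotal V E) : ℝ := p.2 (σ p.1)

theorem contMDiff_hat (σ : Sec B V E) : ContMDiff (dualModel B V) 𝓘(ℝ, ℝ) ∞ (hat σ) := by
  have hp : ContMDiff (dualModel B V) 𝓘(ℝ, B) ∞ (fun p : DualTotal V E => p.1) :=
    contMDiff_proj (DualFiber E)
  have h1 : ContMDiff (dualModel B V) (𝓘(ℝ, B).prod 𝓘(ℝ, V)) ∞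
      (fun p : DualTotal V E => TotalSpace.mk' V p.1 (σ p.1)) := σ.contMDiff.comp hp
  have h2 : ContMDiff (dualModel B V) (dualModel B V) ∞
      (fun p : DualTotal V E => TotalSpace.mk' (V →L[ℝ] ℝ) (E := DualFiber E) p.1 p.2) :=
    contMDiff_id
  have h := ContMDiff.clm_bundle_apply h2 h1
  intro x
  exact (contMDiffAt_totalSpace.1 (h x)).2

theorem contMDiff_proj' : ContMDiff (dualModel B V) 𝓘(ℝ, B) ∞ (proj : DualTotal V E → Q) :=
  contMDiff_proj (DualFiber E)

theorem mfderiv_proj_apply (p : DualTotal V E) (X : TDual B p) :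
    (mfderiv (dualModel B V) 𝓘(ℝ, B) (proj : DualTotal V E → Q) p X : TangentSpace 𝓘(ℝ, B) p.1)
      = (X : B × (V →L[ℝ] ℝ)).1 := by
  have h : HasMFDerivAt (dualModel B V) 𝓘(ℝ, B) (proj : DualTotal V E → Q) p
      (ContinuousLinearMap.fst ℝ B (V →L[ℝ] ℝ)) := by
    have key : ∀ y ∈ (extChartAt (dualModel B V) p).target,
        writtenInExtChartAt (dualModel B V) 𝓘(ℝ, B) p (proj : DualTotal V E → Q) y = y.1 := by
      intro y hy
      have h1 := (extChartAt (dualModel B V) p).right_inv hy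
      have h2 := (extChartAt (dualModel B V) p).map_target hy
      set z := (extChartAt (dualModel B V) p).symm y with hz
      rw [FiberBundle.extChartAt] at h1 h2
      have h3 : z ∈ (trivializationAt (V →L[ℝ] ℝ) (DualFiber E) p.1).source := h2.1
      have h4 := congrArg Prod.fst h1
      have h5 := (trivializationAt (V →L[ℝ] ℝ) (DualFiber E) p.1).coe_fst h3
      refine Eq.trans ?_ h4
      exact congrArg (extChartAt 𝓘(ℝ, B) p.1) h5.symm
    refine ⟨(contMDiff_proj' (B := B)).continuous.continuousAt, ?_⟩
    refine HasFDerivWithinAt.congr_of_eventuallyEq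
      (f := (Prod.fst : B × (V →L[ℝ] ℝ) → B)) hasFDerivWithinAt_fst ?_ ?_
    · have hn : (extChartAt (dualModel B V) p).target ∈ 𝓝 (extChartAt (dualModel B V) p p) :=
        extChartAt_target_mem_nhds p
      refine mem_nhdsWithin_of_mem_nhds (mem_of_superset hn fun y hy => key y hy)
    · exact key _ (mem_extChartAt_target p)
  rw [h.mfderiv]; rfl

variable [FiniteDimensional ℝ B] [T2Space Q]

theorem exists_function (q : Q) (l : TangentSpace 𝓘(ℝ, B) q →L[ℝ] ℝ) :
    ∃ f : C^∞⟮𝓘(ℝ, B), Q; ℝ⟯, mvfderiv 𝓘(ℝ, B) f q = l := by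
  obtain ⟨ψ, hψ, hs⟩ := exists_bump B q (extChartAt_source_mem_nhds (I := 𝓘(ℝ, B)) q)
  let φ := extChartAt 𝓘(ℝ, B) q
  let l' : B →L[ℝ] ℝ := l
  let g : Q → ℝ := fun x => l' (φ x - φ q)
  have hg : ∀ x ∈ φ.source, ContMDiffAt 𝓘(ℝ, B) 𝓘(ℝ, ℝ) ∞ g x := by
    intro x hx
    have h1 : ContMDiffAt 𝓘(ℝ, B) 𝓘(ℝ, B) ∞ φ x := contMDiffAt_extChartAt' (by simpa [φ] using hx)
    have h2 : ContMDiffAt 𝓘(ℝ, B) 𝓘(ℝ, ℝ) ∞ (fun y : B => l' (y - φ q)) (φ x) :=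
      ContDiffAt.contMDiffAt (by fun_prop)
    exact h2.comp x h1
  refine ⟨⟨(ψ : Q → ℝ) * g, contMDiff_of_tsupport fun x hx => ?_⟩, ?_⟩
  · exact ψ.contMDiff.contMDiffAt.mul (hg x (hs (tsupport_mul_subset_left hx)))
  · have hq := (hg q (mem_extChartAt_source q)).mdifferentiableAt (by simp)
    show mvfderiv 𝓘(ℝ, B) ((ψ : Q → ℝ) * g) q = l
    rw [mvfderiv_mul (ψ.contMDiff.mdifferentiableAt (by simp)) hq]
    have : g q = 0 := by simp [g]
    rw [hψ, this]
    rw [one_smul, zero_smul, add_zero, hq.mvfderiv]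
    have h1 : writtenInExtChartAt 𝓘(ℝ, B) 𝓘(ℝ, ℝ) q g =ᶠ[𝓝 (φ q)] fun y => l' (y - φ q) := by
      refine mem_of_superset (extChartAt_target_mem_nhds (I := 𝓘(ℝ, B)) q) fun y hy => ?_
      show l' (φ (φ.symm y) - φ q) = l' (y - φ q)
      rw [φ.right_inv hy]
    rw [ModelWithCorners.range_eq_univ, fderivWithin_univ]
    have h2 : HasFDerivAt (fun y : B => l' (y - φ q)) l' (φ q) :=
      (l'.hasFDerivAt.comp (φ q) ((hasFDerivAt_id (φ q)).sub_const (φ q)))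
    exact (h2.congr_of_eventuallyEq h1).fderiv

theorem fiberPart_spec [FiniteDimensional ℝ V] (p : DualTotal V E) (η : TDual B p →L[ℝ] ℝ)
    (θ : DualFiber E p.1) : θ (fiberPart p η) = η (vertLift p θ) :=
  (existsUnique_fiberPart p η).choose_spec.1 θ

theorem fiberPart_unique [FiniteDimensional ℝ V] (p : DualTotal V E) (η : TDual B p →L[ℝ] ℝ)
    (v : E p.1) (h : ∀ θ : DualFiber E p.1, θ v = η (vertLift p θ)) : fiberPart p η = v :=
  ((existsUnique_fiberPart p η).choose_spec.2 v h).symm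

theorem mvfderiv_vertLift {f : DualTotal V E → ℝ} (p : DualTotal V E)
    (hf : MDifferentiableAt (dualModel B V) 𝓘(ℝ, ℝ) f p) (θ : DualFiber E p.1) :
    mvfderiv (dualModel B V) f p (vertLift p θ) =
      deriv (fun t : ℝ => f ⟨p.1, p.2 + t • θ⟩) 0 := by
  have h0 : (⟨p.1, p.2 + (0 : ℝ) • θ⟩ : DualTotal V E) = p := by simp
  have h1 := (hasMFDerivAt_vertLift (B := B) p θ)
  have h2 := mvfderiv_comp_apply_of_eq (0 : ℝ) hf h1.mdifferentiableAt h0 (1 : ℝ)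
  have h3 : mvfderiv 𝓘(ℝ, ℝ) (f ∘ fun t : ℝ => (⟨p.1, p.2 + t • θ⟩ : DualTotal V E)) (0 : ℝ) (1 : ℝ)
      = deriv (fun t : ℝ => f ⟨p.1, p.2 + t • θ⟩) 0 := by
    simp only [mvfderiv, mfderiv_eq_fderiv]
    show fderiv ℝ (fun t : ℝ => f ⟨p.1, p.2 + t • θ⟩) 0 (1 : ℝ) = _
    exact fderiv_apply_one_eq_deriv
  exact h2.symm.trans h3

theorem fiberPart_hat [FiniteDimensional ℝ V] (p : DualTotal V E) (σ : Sec B V E) :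
    fiberPart p (mvfderiv (dualModel B V) (hat σ) p) = σ p.1 := by
  refine fiberPart_unique _ _ _ fun θ => ?_
  rw [mvfderiv_vertLift p ((contMDiff_hat σ).mdifferentiableAt (by simp))]
  have h : (fun t : ℝ => hat σ (⟨p.1, p.2 + t • θ⟩ : DualTotal V E)) =
      fun t : ℝ => p.2 (σ p.1) + t * θ (σ p.1) := by
    funext t; simp [hat]
  rw [h]
  exact ((((hasDerivAt_id (0 : ℝ)).mul_const _).const_add _).deriv.trans (one_mul _)).symm

theorem fiberPart_base [FiniteDimensional ℝ V] (p : DualTotal V E) (f : C^∞⟮𝓘(ℝ, B), Q; ℝ⟯) :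
    fiberPart p (mvfderiv (dualModel B V) (f ∘ proj) p) = 0 := by
  refine fiberPart_unique _ _ _ fun θ => ?_
  rw [mvfderiv_vertLift p ((f.contMDiff.comp contMDiff_proj').mdifferentiableAt (by simp))]
  simp [proj]

theorem exists_vertical (p : DualTotal V E) (X : TDual B p) (hX : (X : B × (V →L[ℝ] ℝ)).1 = 0) :
    ∃ θ, vertLift p θ = X := by
  set e := trivializationAt (V →L[ℝ] ℝ) (DualFiber E) p.1 with he
  have hq : p.1 ∈ e.baseSet := FiberBundle.mem_baseSet_trivializationAt' p.1
  refine ⟨e.symmL ℝ p.1 (X : B × (V →L[ℝ] ℝ)).2, ?_⟩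
  rw [vertLift_eq]
  have := e.continuousLinearMapAt_symmL (R := ℝ) hq (X : B × (V →L[ℝ] ℝ)).2
  refine (congrArg (Prod.mk (0 : B)) this).trans ?_
  exact Prod.ext hX.symm rfl

theorem apply_eq_of_snd {B W : Type*} [NormedAddCommGroup B] [NormedSpace ℝ B]
    [NormedAddCommGroup W] [NormedSpace ℝ W] (l : B × W →L[ℝ] ℝ) (X : B × W)
    (h : l (0, X.2) = 0) : l X = l (X.1, 0) := by
  have h4 : X = (X.1, 0) + (0, X.2) := by ext <;> simp
  rw [← add_zero (l (X.1, 0)), ← h, ← map_add, ← h4]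

/-- Covectors on `E^*` are differentials of linear functions plus differentials of functions
pulled back from `Q`. -/
theorem exists_decomposition [FiniteDimensional ℝ V] (p : DualTotal V E) (η : TDual B p →L[ℝ] ℝ) :
    ∃ (σ : Sec B V E) (f : C^∞⟮𝓘(ℝ, B), Q; ℝ⟯),
      η = mvfderiv (dualModel B V) (hat σ) p + mvfderiv (dualModel B V) (f ∘ proj) p := by
  obtain ⟨s, hs⟩ := exists_extension B V E p.1
  let η' := η - mvfderiv (dualModel B V) (hat (s (fiberPart p η))) p
  have h1 : ∀ θ, η' (vertLift p θ) = 0 := by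
    intro θ
    have h2 := fiberPart_spec p (mvfderiv (dualModel B V) (hat (s (fiberPart p η))) p) θ
    rw [fiberPart_hat, hs] at h2
    simp only [η', sub_apply, ← h2, fiberPart_spec, sub_self]
  have h2 : ∀ X : TDual B p, η' X = (η' : B × (V →L[ℝ] ℝ) →L[ℝ] ℝ) ((X : B × (V →L[ℝ] ℝ)).1, 0) := by
    intro X
    obtain ⟨θ, hθ⟩ := exists_vertical p
      ((0, (X : B × (V →L[ℝ] ℝ)).2) : B × (V →L[ℝ] ℝ)) rfl
    have h3 := h1 θ
    rw [hθ] at h3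
    exact apply_eq_of_snd (B := B) (W := V →L[ℝ] ℝ) η' X h3
  let l : B →L[ℝ] ℝ := (η' : B × (V →L[ℝ] ℝ) →L[ℝ] ℝ) ∘L ContinuousLinearMap.inl ℝ B (V →L[ℝ] ℝ)
  obtain ⟨f, hf⟩ := exists_function p.1 l
  refine ⟨_, f, (sub_eq_iff_eq_add'.1 (?_ : η' = _))⟩
  ext X
  have h3 := mvfderiv_comp_apply (I := 𝓘(ℝ, B)) (I' := dualModel B V)
    (g := f) (f := (proj : DualTotal V E → Q)) p (f.contMDiff.mdifferentiableAt (by simp))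
    (contMDiff_proj'.mdifferentiableAt (by simp)) X
  rw [h2]
  refine Eq.trans ?_ h3.symm
  rw [mfderiv_proj_apply]
  exact (congrArg (fun m : B →L[ℝ] ℝ => m (X : B × (V →L[ℝ] ℝ)).1) hf).symm

end Poisson
section Dynamics

variable {B : Type*} [NormedAddCommGroup B] [NormedSpace ℝ B]
  {Q : Type*} [TopologicalSpace Q] [ChartedSpace B Q] [IsManifold 𝓘(ℝ, B) ∞ Q]
  {V : Type*} [NormedAddCommGroup V] [NormedSpace ℝ V]
  {E : Q → Type*} [TopologicalSpace (TotalSpace V E)] [∀ q, TopologicalSpace (E q)]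
  [∀ q, AddCommGroup (E q)] [∀ q, Module ℝ (E q)]
  [∀ q, IsTopologicalAddGroup (E q)] [∀ q, ContinuousSMul ℝ (E q)]
  [FiberBundle V E] [VectorBundle ℝ V E] [ContMDiffVectorBundle ∞ V E 𝓘(ℝ, B)]

theorem exists_form {W X : Type*} [AddCommGroup W] [Module ℝ W] [TopologicalSpace W]
    [IsTopologicalAddGroup W] [ContinuousSMul ℝ W] [AddCommGroup X] [Module ℝ X]
    (D : X →ₗ[ℝ] X →ₗ[ℝ] ℝ) (fp : (W →L[ℝ] ℝ) →ₗ[ℝ] X) (U : X →ₗ[ℝ] W) :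
    ∃ P : (W →L[ℝ] ℝ) →ₗ[ℝ] (W →L[ℝ] ℝ) →ₗ[ℝ] ℝ, ∀ η η',
      P η η' = D (fp η) (fp η') + η (U (fp η')) - η' (U (fp η)) :=
  ⟨LinearMap.mk₂ ℝ (fun η η' => D (fp η) (fp η') + η (U (fp η')) - η' (U (fp η)))
      (fun _ _ _ => by simp; ring) (fun _ _ _ => by simp; ring)
      (fun _ _ _ => by simp; ring) (fun _ _ _ => by simp; ring), fun _ _ => rfl⟩

/-- `α` as a map `Q → E^*`. -/
def toMap (α : DualSec B V E) (q : Q) : DualTotal V E := ⟨q, α q⟩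

theorem contMDiff_toMap (α : DualSec B V E) : ContMDiff 𝓘(ℝ, B) (dualModel B V) ∞ (toMap α) :=
  α.contMDiff

namespace Algebroid
variable (A : Algebroid B V E)

/-- `Π` is the value at `p` of the linear almost Poisson bivector of the algebroid: a skew bilinear
form on `T_p^* E^*` such that the bracket `{φ, ψ} = Π(dφ, dψ)` satisfies
`{σ̂, γ̂} = -[σ, γ]^`, `{f ∘ τ, σ̂} = ρ(σ)(f) ∘ τ` and `{f ∘ τ, g ∘ τ} = 0`. -/
structure IsPoissonAt (p : DualTotal V E)
    (P : (TDual B p →L[ℝ] ℝ) →ₗ[ℝ] (TDual B p →L[ℝ] ℝ) →ₗ[ℝ] ℝ) : Prop where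
  skew : ∀ η η', P η η' = -P η' η
  hat_hat : ∀ σ γ : Sec B V E,
    P (mvfderiv (dualModel B V) (hat σ) p) (mvfderiv (dualModel B V) (hat γ) p) =
      -hat (A.bracket σ γ) p
  base_hat : ∀ (f : C^∞⟮𝓘(ℝ, B), Q; ℝ⟯) (σ : Sec B V E),
    P (mvfderiv (dualModel B V) (f ∘ proj) p) (mvfderiv (dualModel B V) (hat σ) p) =
      A.dFun f p.1 (σ p.1)
  base_base : ∀ f g : C^∞⟮𝓘(ℝ, B), Q; ℝ⟯,
    P (mvfderiv (dualModel B V) (f ∘ proj) p) (mvfderiv (dualModel B V) (g ∘ proj) p) = 0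

variable [FiniteDimensional ℝ B] [FiniteDimensional ℝ V] [T2Space Q]

theorem exists_poissonAt (q : Q) (α : DualSec B V E) :
    ∃ P, A.IsPoissonAt (toMap α q) P := by
  obtain ⟨D, hD, -⟩ := A.existsUnique_dForm α q
  let T : TangentSpace 𝓘(ℝ, B) q →L[ℝ] TDual B (toMap α q) :=
    mfderiv 𝓘(ℝ, B) (dualModel B V) (toMap α) q
  have hadd : ∀ η η' : TDual B (toMap α q) →L[ℝ] ℝ,
      fiberPart (toMap α q) (η + η') = fiberPart (toMap α q) η + fiberPart (toMap α q) η' := by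
    intro η η'
    refine fiberPart_unique _ _ _ fun θ => ?_
    simp [fiberPart_spec]
  have hsmul : ∀ (c : ℝ) (η : TDual B (toMap α q) →L[ℝ] ℝ),
      fiberPart (toMap α q) (c • η) = c • fiberPart (toMap α q) η := by
    intro c η
    refine fiberPart_unique _ _ _ fun θ => ?_
    simp [fiberPart_spec]
  let fp : (TDual B (toMap α q) →L[ℝ] ℝ) →ₗ[ℝ] E q :=
    ⟨⟨fiberPart (toMap α q), hadd⟩, hsmul⟩
  obtain ⟨U, hU⟩ : ∃ U : E q →ₗ[ℝ] TDual B (toMap α q), ∀ v, U v = T (A.anchor q v) :=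
    ⟨(T.comp (A.anchor q)).toLinearMap, fun _ => rfl⟩
  have hU0 : ∀ η : TDual B (toMap α q) →L[ℝ] ℝ, η (U 0) = 0 := fun η =>
    (congrArg η (LinearMap.map_zero U)).trans (ContinuousLinearMap.map_zero η)
  have hTσ : ∀ (σ : Sec B V E) (v : E q),
      mvfderiv (dualModel B V) (hat σ) (toMap α q) (U v) =
        A.dFun (pair α σ) q v := by
    intro σ v
    rw [hU]
    exact (mvfderiv_comp_apply (I := dualModel B V) (I' := 𝓘(ℝ, B)) (g := hat σ) (f := toMap α) q
      ((contMDiff_hat σ).mdifferentiableAt (by simp))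
      ((contMDiff_toMap α).mdifferentiableAt (by simp)) (A.anchor q v)).symm
  have hTf : ∀ (f : C^∞⟮𝓘(ℝ, B), Q; ℝ⟯) (v : E q),
      mvfderiv (dualModel B V) (f ∘ proj) (toMap α q) (U v) = A.dFun f q v := by
    intro f v
    rw [hU]
    exact (mvfderiv_comp_apply (I := dualModel B V) (I' := 𝓘(ℝ, B)) (g := f ∘ proj)
      (f := toMap α) q
      ((f.contMDiff.comp contMDiff_proj').mdifferentiableAt (by simp))
      ((contMDiff_toMap α).mdifferentiableAt (by simp)) (A.anchor q v)).symm
  have hDskew : ∀ u v, D u v = -D v u := by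
    intro u v
    obtain ⟨s, hs⟩ := exists_extension B V E q
    rw [← hs u, ← hs v, hD, hD, A.dFormSec_skew]
  have fpσ : ∀ σ : Sec B V E, fp (mvfderiv (dualModel B V) (hat σ) (toMap α q)) = σ q :=
    fun σ => fiberPart_hat _ σ
  have fpf : ∀ f : C^∞⟮𝓘(ℝ, B), Q; ℝ⟯,
      fp (mvfderiv (dualModel B V) (f ∘ proj) (toMap α q)) = 0 :=
    fun f => fiberPart_base _ f
  obtain ⟨P, hP⟩ := exists_form D fp U
  refine ⟨P, ⟨fun η η' => ?_, fun σ γ => ?_, fun f σ => ?_, fun f g => ?_⟩⟩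
  · rw [hP, hP, hDskew]; ring
  · rw [hP, fpσ, fpσ, hD, hTσ, hTσ, dFormSec]
    have : hat (A.bracket σ γ) (toMap α q) = pair α (A.bracket σ γ) q := rfl
    rw [this]; ring
  · rw [hP, fpσ, fpf, hTf, hU0, map_zero, LinearMap.zero_apply]
    simp [toMap]
    rfl
  · rw [hP, fpf, fpf, hU0, hU0, map_zero]
    simp

theorem existsUnique_poissonAt (p : DualTotal V E) : ∃! P, A.IsPoissonAt p P := by
  obtain ⟨s, hs⟩ := exists_extension B (V →L[ℝ] ℝ) (DualFiber E) p.1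
  have hp : toMap (s p.2) p.1 = p := by
    rw [toMap, hs]
  obtain ⟨P, hP⟩ : ∃ P, A.IsPoissonAt p P := by
    have h := A.exists_poissonAt p.1 (s p.2)
    rwa [hp] at h
  refine ⟨P, hP, fun P' hP' => ?_⟩
  refine LinearMap.ext₂ fun η η' => ?_
  obtain ⟨σ, f, rfl⟩ := exists_decomposition p η
  obtain ⟨γ, g, rfl⟩ := exists_decomposition p η'
  have hP' : A.IsPoissonAt p P' := hP'
  simp only [map_add, LinearMap.add_apply, hP.hat_hat, hP'.hat_hat, hP.base_hat, hP'.base_hat,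
    hP.base_base, hP'.base_base]
  rw [hP.skew _ (mvfderiv (dualModel B V) (g ∘ proj) p),
    hP'.skew _ (mvfderiv (dualModel B V) (g ∘ proj) p), hP.base_hat, hP'.base_hat]

/-- The linear almost Poisson bivector `Π_{E^*}` at `p ∈ E^*`. -/
def poisson (p : DualTotal V E) :
    (TDual B p →L[ℝ] ℝ) →ₗ[ℝ] (TDual B p →L[ℝ] ℝ) →ₗ[ℝ] ℝ :=
  (A.existsUnique_poissonAt p).choose

theorem existsUnique_hamiltonian (H : DualTotal V E → ℝ) (p : DualTotal V E) :
    ∃! X : TDual B p, ∀ η : TDual B p →L[ℝ] ℝ,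
      η X = -A.poisson p (mvfderiv (dualModel B V) H p) η := by
  have : FiniteDimensional ℝ (TDual B p) :=
    inferInstanceAs (FiniteDimensional ℝ (B × (V →L[ℝ] ℝ)))
  have : T2Space (TDual B p) := inferInstanceAs (T2Space (B × (V →L[ℝ] ℝ)))
  exact existsUnique_dual_repr (-A.poisson p (mvfderiv (dualModel B V) H p))

/-- The hamiltonian vector field `𝓗_H = -i_{dH} Π_{E^*}` on `E^*`. -/
def hamiltonianField (H : DualTotal V E → ℝ) (p : DualTotal V E) : TDual B p :=
  (A.existsUnique_hamiltonian H p).choose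

/-- The vector field `Tτ ∘ 𝓗_H ∘ α` on `Q`. -/
def baseField (H : DualTotal V E → ℝ) (α : DualSec B V E) (q : Q) : TangentSpace 𝓘(ℝ, B) q :=
  mfderiv (dualModel B V) 𝓘(ℝ, B) (proj : DualTotal V E → Q) (toMap α q)
    (A.hamiltonianField H (toMap α q))

end Algebroid

variable [FiniteDimensional ℝ B] [FiniteDimensional ℝ V] [T2Space Q]

/-- The section `ζ_H^α` of `E`, characterized by `β(ζ_H^α) = β^∨(H) ∘ α` for `β ∈ Γ(E^*)`. -/
def zeta (H : DualTotal V E → ℝ) (α : DualSec B V E) (q : Q) : E q :=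
  fiberPart (toMap α q) (mvfderiv (dualModel B V) H (toMap α q))

/-- The vector field `(F^*)^∨` on `E^*`: the vertical lift of `F^* p = p ∘ F` at each `p ∈ E^*`. -/
def forceField (F : Sec B (V →L[ℝ] V) (fun q => E q →L[ℝ] E q)) (p : DualTotal V E) : TDual B p :=
  vertLift p (p.2 ∘L F p.1)

end Dynamics
end SkewAlgebroid

end

open SkewAlgebroid

namespace SkewAlgebroid

/-! Write `p = α(q)` and `v` for the fibre part of a covector `η` at `p`. At points in the image of
`α` the bivector splits along the tangent lift of the anchor. With `ζ` the fibre part of `dH`, this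
gives `η(𝓗_H(p)) = η(Tα(ρ(ζ))) - (d^E α(ζ, v) + d^E(H ∘ α)(v))`, which is `apply_hamiltonianField`.
Both sides are additive in `dH` and in `η`, and every covector is the differential of a linear
function plus that of a function pulled back from `Q`. The identity therefore only has to be checked
on these generators, where it unwinds to the definition of `d^E α`.

If `η` is pulled back from `Q`, then `v = 0` and the identity says that the base field is `ρ(ζ)`
(`baseField_eq`). For general `η`, since `η((F^*)^∨(p)) = α(F v)`, the vectors `Tα(ρ(ζ))` and `𝓗_H -
(F^*)^∨` at `p` differ exactly by the Hamilton–Jacobi covector evaluated on `v`. Hence the equation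
at `q` is equivalent to `Tα` carrying the base field at `q` to the forced field at `α(q)`
(`mfderiv_baseField_eq_iff`).

The chain rule then turns the equation into the statement about curves. For the converse, an
integral curve is needed through every point of `Q`; it exists because `ζ`, and so `ρ(ζ)`, is `C^1`
(`contMDiffAt_zeta`, `contMDiffAt_baseField`). Comparing velocities at time 0 recovers the pointwise
relation. -/

theorem comp_smulRight_one {X Y : Type*} [AddCommGroup X] [Module ℝ X] [TopologicalSpace X]
    [ContinuousSMul ℝ X] [AddCommGroup Y] [Module ℝ Y] [TopologicalSpace Y] [ContinuousSMul ℝ Y]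
    (T : X →L[ℝ] Y) (x : X) :
    T ∘L (1 : ℝ →L[ℝ] ℝ).smulRight x = (1 : ℝ →L[ℝ] ℝ).smulRight (T x) := by
  ext; simp

/-- Integral curves record a velocity `x` as the map `t ↦ t • x`; evaluation at 1 recovers `x`. -/
theorem smulRight_one_injective {X : Type*} [AddCommGroup X] [Module ℝ X] [TopologicalSpace X]
    [ContinuousSMul ℝ X] :
    Function.Injective fun x : X => (1 : ℝ →L[ℝ] ℝ).smulRight x := by
  intro x y h
  simpa using DFunLike.congr_fun h (1 : ℝ)

variable {B : Type*} [NormedAddCommGroup B] [NormedSpace ℝ B]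
  {Q : Type*} [TopologicalSpace Q] [ChartedSpace B Q] [IsManifold 𝓘(ℝ, B) ∞ Q]
  {V : Type*} [NormedAddCommGroup V] [NormedSpace ℝ V]
  {E : Q → Type*} [TopologicalSpace (TotalSpace V E)] [∀ q, TopologicalSpace (E q)]
  [∀ q, AddCommGroup (E q)] [∀ q, Module ℝ (E q)]
  [∀ q, IsTopologicalAddGroup (E q)] [∀ q, ContinuousSMul ℝ (E q)]
  [FiberBundle V E] [VectorBundle ℝ V E] [ContMDiffVectorBundle ∞ V E 𝓘(ℝ, B)]

/-! ### Regularity of the section `ζ`. -/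

variable (V E) in
/-- The covector at `q` obtained by reading vectors in the trivialization around `q₀` and applying
a fixed functional `l` of the model fibre. -/
noncomputable def localCovector (q₀ : Q) (l : V →L[ℝ] ℝ) (q : Q) : DualFiber E q :=
  l ∘L (trivializationAt V E q₀).continuousLinearMapAt ℝ q

/-- Read in the trivializations at `q₀`, this family of covectors is the constant `l` near `q₀`. -/
theorem contMDiffAt_localCovector (q₀ : Q) (l : V →L[ℝ] ℝ) :
    ContMDiffAt 𝓘(ℝ, B) (dualModel B V) ∞
      (fun q => (⟨q, localCovector V E q₀ l q⟩ : DualTotal V E)) q₀ := by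
  refine (contMDiffAt_hom_bundle (IB := 𝓘(ℝ, B)) (F₁ := V) (E₁ := E) (F₂ := ℝ)
    (E₂ := Bundle.Trivial Q ℝ) _).2 ⟨contMDiffAt_id, ?_⟩
  refine (contMDiffAt_const (c := l)).congr_of_eventuallyEq ?_
  filter_upwards [(trivializationAt V E q₀).open_baseSet.mem_nhds
    (FiberBundle.mem_baseSet_trivializationAt' q₀)] with q hq
  ext v
  have h := (trivializationAt V E q₀).continuousLinearMapAt_symmL (R := ℝ) hq v
  simp only [ContinuousLinearMap.inCoordinates, localCovector]
  simp [h]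

/-- In the dual trivialization at `q₀` the map has fibre coordinate `e(α) + t e(β)`, because
trivializations are linear on fibres over the base set. -/
theorem contMDiffAt_add_smul (α : DualSec B V E) {β : ∀ q, DualFiber E q} {q₀ : Q}
    (hβ : ContMDiffAt 𝓘(ℝ, B) (dualModel B V) ∞ (fun q => (⟨q, β q⟩ : DualTotal V E)) q₀) :
    ContMDiffAt (𝓘(ℝ, B).prod 𝓘(ℝ, ℝ)) (dualModel B V) ∞
      (fun x : Q × ℝ => (⟨x.1, α x.1 + x.2 • β x.1⟩ : DualTotal V E)) (q₀, 0) := by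
  have hα := (contMDiffAt_totalSpace.1 (α.contMDiff q₀)).2
  have hβ := (contMDiffAt_totalSpace.1 hβ).2
  have hfst : ContMDiffAt (𝓘(ℝ, B).prod 𝓘(ℝ, ℝ)) 𝓘(ℝ, B) ∞ (Prod.fst : Q × ℝ → Q) (q₀, 0) :=
    contMDiffAt_fst
  have hsnd : ContMDiffAt (𝓘(ℝ, B).prod 𝓘(ℝ, ℝ)) 𝓘(ℝ, ℝ) ∞ (Prod.snd : Q × ℝ → ℝ) (q₀, 0) :=
    contMDiffAt_snd
  refine contMDiffAt_totalSpace.2 ⟨hfst, ?_⟩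
  refine ((hα.comp (q₀, (0 : ℝ)) hfst).add
    (hsnd.smul (hβ.comp (q₀, (0 : ℝ)) hfst))).congr_of_eventuallyEq ?_
  set e := trivializationAt (V →L[ℝ] ℝ) (DualFiber E) q₀ with he
  filter_upwards [continuousAt_fst.preimage_mem_nhds (e.open_baseSet.mem_nhds
    (FiberBundle.mem_baseSet_trivializationAt' q₀))] with x hx
  have h := map_add (e.continuousLinearMapAt ℝ x.1) (α x.1) (x.2 • β x.1)
  rw [map_smul] at h
  simpa [Trivialization.continuousLinearMapAt_apply, e.coe_linearMapAt_of_mem hx] using h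

variable [FiniteDimensional ℝ B] [FiniteDimensional ℝ V] [T2Space Q]

/-- This turns the algebraic characterization of `ζ` into a fibre derivative of `H`, a form that can
be differentiated in `q`. -/
theorem apply_zeta {H : DualTotal V E → ℝ} (hH : ContMDiff (dualModel B V) 𝓘(ℝ, ℝ) ∞ H)
    (α : DualSec B V E) (q : Q) (θ : DualFiber E q) :
    θ (zeta H α q) = deriv (fun t : ℝ => H ⟨q, α q + t • θ⟩) 0 :=
  (fiberPart_spec (toMap α q) _ θ).trans
    (mvfderiv_vertLift (toMap α q) (hH.mdifferentiableAt (by simp)) θ)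

/-- A coordinate `l` of `ζ` in the trivialization at `q₀` is the derivative at `t = 0` of `H(α + t
β)`, with `β` the local covector field of `l`. It is thus a partial derivative of a smooth function
of `(q, t)`. Order `C^1` is what the existence of integral curves requires. -/
theorem contMDiffAt_zeta {H : DualTotal V E → ℝ}
    (hH : ContMDiff (dualModel B V) 𝓘(ℝ, ℝ) ∞ H) (α : DualSec B V E) (q₀ : Q) :
    ContMDiffAt 𝓘(ℝ, B) (𝓘(ℝ, B).prod 𝓘(ℝ, V)) 1
      (fun q => TotalSpace.mk' V q (zeta H α q)) q₀ := by
  refine contMDiffAt_totalSpace.2 ⟨contMDiffAt_id, ?_⟩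
  set e := trivializationAt V E q₀ with he
  have key : ∀ l : V →L[ℝ] ℝ, ContMDiffAt 𝓘(ℝ, B) 𝓘(ℝ, ℝ) 1
      (fun q => l (e ⟨q, zeta H α q⟩).2) q₀ := by
    intro l
    have hf : ContMDiffAt (𝓘(ℝ, B).prod 𝓘(ℝ, ℝ)) 𝓘(ℝ, ℝ) ∞
        (Function.uncurry fun (q : Q) (t : ℝ) =>
          H ⟨q, α q + t • localCovector V E q₀ l q⟩) (q₀, 0) :=
      ContMDiffAt.comp (g := H) (q₀, (0 : ℝ)) hH.contMDiffAt
        (contMDiffAt_add_smul α (contMDiffAt_localCovector q₀ l))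
    have h := ContMDiffAt.mfderiv (m := 1) (fun (q : Q) (t : ℝ) =>
      H ⟨q, α q + t • localCovector V E q₀ l q⟩) (fun _ => (0 : ℝ)) hf contMDiffAt_const
      (by norm_cast)
    have h' : ContMDiffAt 𝓘(ℝ, B) 𝓘(ℝ, ℝ →L[ℝ] ℝ) 1
        (fun q => fderiv ℝ (fun t : ℝ => H ⟨q, α q + t • localCovector V E q₀ l q⟩) 0) q₀ := by
      -- The parametric derivative comes in tangent coordinates, which are trivial for maps from `ℝ`
      -- to `ℝ`.
      refine h.congr_of_eventuallyEq (Eventually.of_forall fun q => ?_)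
      have := congrFun (inTangentCoordinates_model_space (I := 𝓘(ℝ, ℝ)) (I' := 𝓘(ℝ, ℝ))
        (fun _ : Q => (0 : ℝ)) (fun q => H ⟨q, α q + (0 : ℝ) • localCovector V E q₀ l q⟩)
        (fun q => fderiv ℝ (fun t : ℝ => H ⟨q, α q + t • localCovector V E q₀ l q⟩) 0) q₀) q
      refine this.symm.trans ?_
      simp only [mfderiv_eq_fderiv]
    have h'' := h'.clm_apply (contMDiffAt_const (c := (1 : ℝ)))
    refine h''.congr_of_eventuallyEq ?_
    filter_upwards [e.open_baseSet.mem_nhds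
      (FiberBundle.mem_baseSet_trivializationAt' q₀)] with q hq
    rw [fderiv_apply_one_eq_deriv, ← apply_zeta hH α q]
    simp [localCovector, Trivialization.continuousLinearMapAt_apply, ← he,
      e.coe_linearMapAt_of_mem hq]
  -- `V` is finite-dimensional, so it suffices to test against the coordinate functionals of a
  -- basis.
  let b := (Module.finBasis ℝ V).equivFunL
  have hb : ContMDiffAt 𝓘(ℝ, B) 𝓘(ℝ, Fin (Module.finrank ℝ V) → ℝ) 1
      (fun q => b (e ⟨q, zeta H α q⟩).2) q₀ :=
    contMDiffAt_pi_space.2 fun i =>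
      key ((ContinuousLinearMap.proj i : (Fin (Module.finrank ℝ V) → ℝ) →L[ℝ] ℝ) ∘L
        (b : V →L[ℝ] Fin (Module.finrank ℝ V) → ℝ))
  have hs := (b.symm.contDiff.contMDiff (n := 1)).contMDiffAt.comp q₀ hb
  exact hs.congr_of_eventuallyEq (Eventually.of_forall fun q => (b.symm_apply_apply _).symm)

/-! ### The hamiltonian field along the image of `α`. -/

namespace Algebroid
variable (A : Algebroid B V E)

theorem dForm_apply (α : DualSec B V E) (q : Q) (σ γ : Sec B V E) :
    A.dForm α q (σ q) (γ q) = A.dFormSec α σ γ q :=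
  (A.existsUnique_dForm α q).choose_spec.1 σ γ

theorem isPoissonAt_poisson (p : DualTotal V E) : A.IsPoissonAt p (A.poisson p) :=
  (A.existsUnique_poissonAt p).choose_spec.1

theorem hamiltonianField_spec (H : DualTotal V E → ℝ) (p : DualTotal V E)
    (η : TDual B p →L[ℝ] ℝ) :
    η (A.hamiltonianField H p) = -A.poisson p (mvfderiv (dualModel B V) H p) η :=
  (A.existsUnique_hamiltonian H p).choose_spec.1 η

/-- Chain rule for `hat σ ∘ toMap α = pair α σ`. -/
theorem mvfderiv_hat_mfderiv (α : DualSec B V E) (σ : Sec B V E) (q : Q)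
    (u : TangentSpace 𝓘(ℝ, B) q) :
    mvfderiv (dualModel B V) (hat σ) (toMap α q)
      (mfderiv 𝓘(ℝ, B) (dualModel B V) (toMap α) q u) = mvfderiv 𝓘(ℝ, B) (pair α σ) q u :=
  (mvfderiv_comp_apply (I := dualModel B V) (I' := 𝓘(ℝ, B)) (g := hat σ) (f := toMap α) q
    ((contMDiff_hat σ).mdifferentiableAt (by simp))
    ((contMDiff_toMap α).mdifferentiableAt (by simp)) u).symm

/-- Chain rule, with `toMap α` a section of `proj`. -/
theorem mvfderiv_comp_proj_mfderiv (α : DualSec B V E) (f : C^∞⟮𝓘(ℝ, B), Q; ℝ⟯) (q : Q)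
    (u : TangentSpace 𝓘(ℝ, B) q) :
    mvfderiv (dualModel B V) (f ∘ proj) (toMap α q)
      (mfderiv 𝓘(ℝ, B) (dualModel B V) (toMap α) q u) = mvfderiv 𝓘(ℝ, B) f q u :=
  (mvfderiv_comp_apply (I := dualModel B V) (I' := 𝓘(ℝ, B)) (g := f ∘ proj) (f := toMap α) q
    ((f.contMDiff.comp contMDiff_proj').mdifferentiableAt (by simp))
    ((contMDiff_toMap α).mdifferentiableAt (by simp)) u).symm

/-- The defect between the hamiltonian vector field along `α` and the tangent lift of `ρ(ζ)` is the
Hamilton–Jacobi covector. -/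
theorem apply_hamiltonianField {H : DualTotal V E → ℝ}
    (hH : ContMDiff (dualModel B V) 𝓘(ℝ, ℝ) ∞ H) (α : DualSec B V E) (q : Q)
    (η : TDual B (toMap α q) →L[ℝ] ℝ) (v : E q) (hv : fiberPart (toMap α q) η = v) :
    η (A.hamiltonianField H (toMap α q)) =
      η (mfderiv 𝓘(ℝ, B) (dualModel B V) (toMap α) q (A.anchor q (zeta H α q))) -
        (A.dForm α q (zeta H α q) v + A.dFun (H ∘ toMap α) q v) := by
  have hP := A.isPoissonAt_poisson (toMap α q)
  have hd : ∀ (f : Q → ℝ) (v : E q), A.dFun f q v = mvfderiv 𝓘(ℝ, B) f q (A.anchor q v) :=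
    fun _ _ => rfl
  have hchain : A.dFun (H ∘ toMap α) q v = mvfderiv (dualModel B V) H (toMap α q)
      (mfderiv 𝓘(ℝ, B) (dualModel B V) (toMap α) q (A.anchor q v)) :=
    mvfderiv_comp_apply (I := dualModel B V) (I' := 𝓘(ℝ, B)) (g := H) (f := toMap α) q
      (hH.mdifferentiableAt (by simp)) ((contMDiff_toMap α).mdifferentiableAt (by simp)) _
  have hfib : ∀ (σ : Sec B V E) (f : C^∞⟮𝓘(ℝ, B), Q; ℝ⟯), fiberPart (toMap α q)
      (mvfderiv (dualModel B V) (hat σ) (toMap α q) +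
        mvfderiv (dualModel B V) (f ∘ proj) (toMap α q)) = σ q := by
    intro σ f
    refine fiberPart_unique _ _ _ fun θ => ?_
    rw [add_apply, ← fiberPart_spec, ← fiberPart_spec, fiberPart_hat, fiberPart_base, map_zero,
      add_zero]
    rfl
  have hhat : ∀ σ γ : Sec B V E, A.poisson (toMap α q)
      (mvfderiv (dualModel B V) (hat σ) (toMap α q))
      (mvfderiv (dualModel B V) (hat γ) (toMap α q)) = -pair α (A.bracket σ γ) q := hP.hat_hat
  have hbase : ∀ (f : C^∞⟮𝓘(ℝ, B), Q; ℝ⟯) (σ : Sec B V E), A.poisson (toMap α q)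
      (mvfderiv (dualModel B V) (f ∘ proj) (toMap α q))
      (mvfderiv (dualModel B V) (hat σ) (toMap α q)) =
        mvfderiv 𝓘(ℝ, B) f q (A.anchor q (σ q)) := hP.base_hat
  rw [A.hamiltonianField_spec, hchain]
  rw [zeta]
  -- `H` now enters only through its differential at `α(q)`, so that covector can be made arbitrary
  -- and decomposed into generators.
  generalize mvfderiv (dualModel B V) H (toMap α q) = χ
  obtain ⟨σ, f, rfl⟩ := exists_decomposition _ χ
  obtain ⟨γ, g, rfl⟩ := exists_decomposition _ η
  rw [hfib] at hv
  rw [hfib, ← hv, A.dForm_apply]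
  -- The bivector expands into four brackets of generators; skewness puts the linear-by-pulled-back
  -- one into the form of `hbase`. What remains are the terms of `d^E α(σ, γ)` and derivatives along
  -- the anchor.
  simp only [map_add, LinearMap.add_apply, add_apply, hhat, hbase,
    hP.base_base, mvfderiv_hat_mfderiv, mvfderiv_comp_proj_mfderiv, dFormSec, hd,
    hP.skew (mvfderiv (dualModel B V) (hat σ) (toMap α q))
      (mvfderiv (dualModel B V) (g ∘ proj) (toMap α q))]
  ring

/-- Covectors pulled back from `Q` have zero fibre part, so the Hamilton–Jacobi term drops out of
`apply_hamiltonianField`. Differentials of global functions exhaust the cotangent space of `Q`,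
hence separate tangent vectors. -/
theorem baseField_eq {H : DualTotal V E → ℝ}
    (hH : ContMDiff (dualModel B V) 𝓘(ℝ, ℝ) ∞ H) (α : DualSec B V E) (q : Q) :
    A.baseField H α q = A.anchor q (zeta H α q) := by
  have hsep : ∀ u w : TangentSpace 𝓘(ℝ, B) q,
      (∀ f : C^∞⟮𝓘(ℝ, B), Q; ℝ⟯, mvfderiv 𝓘(ℝ, B) f q u = mvfderiv 𝓘(ℝ, B) f q w) → u = w := by
    intro u w h
    have h' : ∀ l : B →L[ℝ] ℝ, l u = l w := by
      intro l
      obtain ⟨f, hf⟩ := exists_function q l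
      have := h f
      rwa [hf] at this
    exact (SeparatingDual.eq_iff_forall_dual_eq (R := ℝ) (V := B)).2 h'
  refine hsep _ _ fun f => ?_
  have h := A.apply_hamiltonianField hH α q (mvfderiv (dualModel B V) (f ∘ proj) (toMap α q)) 0
    (fiberPart_base _ f)
  rw [map_zero, map_zero, add_zero, sub_zero, mvfderiv_comp_proj_mfderiv] at h
  rw [← h]
  exact (mvfderiv_comp_apply (I := 𝓘(ℝ, B)) (I' := dualModel B V)
    (g := f) (f := (proj : DualTotal V E → Q)) (toMap α q)
    (f.contMDiff.mdifferentiableAt (by simp))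
    (contMDiff_proj'.mdifferentiableAt (by simp)) _).symm

/-- The base field is the smooth anchor applied to the `C^1` section `ζ`; this supplies the
regularity for integral curves through every point. -/
theorem contMDiffAt_baseField {H : DualTotal V E → ℝ}
    (hH : ContMDiff (dualModel B V) 𝓘(ℝ, ℝ) ∞ H) (α : DualSec B V E) (q : Q) :
    ContMDiffAt 𝓘(ℝ, B) 𝓘(ℝ, B).tangent 1
      (fun q => (⟨q, A.baseField H α q⟩ : TangentBundle 𝓘(ℝ, B) Q)) q := by
  have : IsManifold 𝓘(ℝ, B) (1 + 1) Q := .of_le (n := ∞) (by norm_cast)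
  have hA := (A.anchor.contMDiff q).of_le (m := 1) (by simp)
  simp only [A.baseField_eq hH]
  exact hA.clm_bundle_apply (contMDiffAt_zeta hH α q)

/-- Along `α` the forced hamiltonian field is the tangent lift of the base field exactly where the
Hamilton–Jacobi equation holds. -/
theorem mfderiv_baseField_eq_iff {H : DualTotal V E → ℝ}
    (hH : ContMDiff (dualModel B V) 𝓘(ℝ, ℝ) ∞ H)
    (F : Sec B (V →L[ℝ] V) (fun q => E q →L[ℝ] E q)) (α : DualSec B V E) (q : Q) :
    mfderiv 𝓘(ℝ, B) (dualModel B V) (toMap α) q (A.baseField H α q) =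
        A.hamiltonianField H (toMap α q) - forceField F (toMap α q) ↔
      ∀ v : E q,
        A.dForm α q (zeta H α q) v + A.dFun (H ∘ toMap α) q v + α q (F q v) = 0 := by
  -- Paired with any `η`, the difference of the two vectors is the Hamilton–Jacobi covector on the
  -- fibre part of `η`.
  have key : ∀ (η : TDual B (toMap α q) →L[ℝ] ℝ) (v : E q), fiberPart (toMap α q) η = v →
      η (mfderiv 𝓘(ℝ, B) (dualModel B V) (toMap α) q (A.baseField H α q)) -
        η (A.hamiltonianField H (toMap α q) - forceField F (toMap α q)) =
      A.dForm α q (zeta H α q) v + A.dFun (H ∘ toMap α) q v + α q (F q v) := by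
    intro η v hv
    have h : α q (F q v) = η (forceField F (toMap α q)) := by
      subst hv
      exact fiberPart_spec (toMap α q) η (α q ∘L F q)
    have h' := ContinuousLinearMap.map_sub η (A.hamiltonianField H (toMap α q))
      (forceField F (toMap α q))
    rw [h', h, A.apply_hamiltonianField hH α q η v hv, A.baseField_eq hH]
    ring
  constructor
  · intro h v
    -- Every `v` occurs as a fibre part: extend it to a section and take the differential of the
    -- associated linear function.
    obtain ⟨s, hs⟩ := exists_extension B V E q
    rw [← key _ v ((fiberPart_hat (toMap α q) (s v)).trans (hs v)), h, sub_self]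
  · intro h
    -- Conversely, covectors separate the points of `T_p E^*`, whose model is `B × (V →L[ℝ] ℝ)`.
    have h' : ∀ η : B × (V →L[ℝ] ℝ) →L[ℝ] ℝ,
        η (mfderiv 𝓘(ℝ, B) (dualModel B V) (toMap α) q (A.baseField H α q)) =
          η (A.hamiltonianField H (toMap α q) - forceField F (toMap α q)) :=
      fun η => sub_eq_zero.1 ((key η _ rfl).trans (h _))
    exact (SeparatingDual.eq_iff_forall_dual_eq (R := ℝ) (V := B × (V →L[ℝ] ℝ))).2 h'

end Algebroid
end SkewAlgebroid

/-! ### From the pointwise relation to integral curves. -/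

theorem corollary4p1
    {B : Type*} [NormedAddCommGroup B] [NormedSpace ℝ B] [FiniteDimensional ℝ B]
    {Q : Type*} [TopologicalSpace Q] [T2Space Q] [ChartedSpace B Q] [IsManifold 𝓘(ℝ, B) ∞ Q]
    {V : Type*} [NormedAddCommGroup V] [NormedSpace ℝ V] [FiniteDimensional ℝ V]
    {E : Q → Type*} [TopologicalSpace (TotalSpace V E)] [∀ q, TopologicalSpace (E q)]
    [∀ q, AddCommGroup (E q)] [∀ q, Module ℝ (E q)]
    [∀ q, IsTopologicalAddGroup (E q)] [∀ q, ContinuousSMul ℝ (E q)]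
    [FiberBundle V E] [VectorBundle ℝ V E] [ContMDiffVectorBundle ∞ V E 𝓘(ℝ, B)]
    (A : Algebroid B V E)
    (H : DualTotal V E → ℝ) (hH : ContMDiff (dualModel B V) 𝓘(ℝ, ℝ) ∞ H)
    (F : Sec B (V →L[ℝ] V) (fun q => E q →L[ℝ] E q))
    (α : DualSec B V E) :
    (∀ (c : ℝ → Q) (s : Set ℝ), IsOpen s → s.OrdConnected →
        IsMIntegralCurveOn c (A.baseField H α) s →
        IsMIntegralCurveOn (toMap α ∘ c) (fun p => A.hamiltonianField H p - forceField F p) s) ↔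
      ∀ (q : Q) (v : E q),
        A.dForm α q (zeta H α q) v + A.dFun (H ∘ toMap α) q v + α q (F q v) = 0 := by
  constructor
  · intro h q
    rw [← A.mfderiv_baseField_eq_iff hH]
    have : CompleteSpace B := FiniteDimensional.complete ℝ B
    have : IsManifold 𝓘(ℝ, B) 1 Q := .of_le (n := ∞) (by simp)
    -- Picard–Lindelöf gives a curve starting at the given point, which becomes `c 0`; a ball around
    -- 0 in `ℝ` serves as the open interval.
    obtain ⟨c, rfl, hc⟩ := exists_isMIntegralCurveAt_of_contMDiffAt_boundaryless (t₀ := 0)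
      (A.contMDiffAt_baseField hH α q)
    obtain ⟨ε, hε, hc⟩ := isMIntegralCurveAt_iff'.1 hc
    have hord : (Metric.ball (0 : ℝ) ε).OrdConnected := (convex_ball _ _).ordConnected
    have hball : Metric.ball (0 : ℝ) ε ∈ 𝓝 0 := Metric.ball_mem_nhds _ hε
    have h0 := (hc 0 (Metric.mem_ball_self hε)).hasMFDerivAt hball
    have h1 := (h c _ Metric.isOpen_ball hord hc 0 (Metric.mem_ball_self hε)).hasMFDerivAt hball
    -- The velocity of `α ∘ c` at 0 is computed twice: here by the chain rule, in `h1` from the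
    -- assumption on integral curves.
    have h2 := ((contMDiff_toMap α).mdifferentiableAt (x := c 0) (by simp)).hasMFDerivAt.comp 0 h0
    have h3 := hasMFDerivAt_unique h2 h1
    exact smulRight_one_injective ((comp_smulRight_one _ _).symm.trans h3)
  · intro h c s hs _ hc t ht
    have h0 := (hc t ht)
    have h2 := ((contMDiff_toMap α).mdifferentiableAt
      (x := c t) (by simp)).hasMFDerivAt.comp_hasMFDerivWithinAt t h0
    -- The equation at `c t` identifies the velocity given by the chain rule with the forced field
    -- at `α (c t)`.
    have h3 := (A.mfderiv_baseField_eq_iff hH F α (c t)).2 (h (c t))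
    exact (h2.congr_mfderiv (comp_smulRight_one _ _)).congr_mfderiv
      (congrArg (fun x => (1 : ℝ →L[ℝ] ℝ).smulRight x) h3)
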